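/- Graphs are finite, simple and undirected with a non-empty vertex set; $\hom(F,G)$ is the number of homomorphisms from $F$ to $G$; $K_1$ is the graph with one vertex; classes of graphs are closed under isomorphism. For $k\ge 1$, a \emph{$k$ adaptive hom algorithm} for a class $\mathcal C$ of graphs consists of a graph $F$ (the starting graph), a function $N$ assigning a graph to every tuple in $\bigcup_{1\le i\le k-1}\mathbb N^i$ (the next graph function), and a set $X\subseteq\mathbb N^k$, such that for all graphs $G$, \[ G\in\mathcal C\iff (n_1,\dots,n_k)\in X,\qquad\text{where } n_1=\hom(F,G),\quad n_{i+1}=\hom(N(n_1,\dots,n_i),G)\ \ (1\le i<k). \] (No computability of $N$ or $X$ is required.) \textbf{Theorem.} For every $n\ge 1$ there are graphs $F_1(n)$ and $F_2(n)$ such that the following hold. \begin{enumerate} \item[(i)] For every $n\ge 1$ and all graphs $G$ and $H$ with $|V(G)|=|V(H)|=n$: if $\hom(F_i(n),G)=\hom(F_i(n),H)$ for $i\in\{1,2\}$, then $G\cong H$. \item[(ii)] For all graphs $G$ and $H$: if $n_0:=\hom(K_1,G)=\hom(K_1,H)$, $\hom(F_1(n_0),G)=\hom(F_1(n_0),H)$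 and $\hom(F_2(n_0),G)=\hom(F_2(n_0),H)$, then $G\cong H$. \item[(iii)] Every class of graphs can be decided by a $3$ adaptive hom algorithm; moreover the algorithm can be chosen with starting graph $K_1$ and with next graph function satisfying $N(n)=F_1(n)$ and $N(n,n')=F_2(n)$ for all $n\ge 1$ and $n'\ge 0$. \end{enumerate} -/

import Mathlib

/-- A graph: finite, simple, undirected, with a non-empty vertex set. -/
structure FinGraph where
  V : Type
  [finite : Finite V]
  [nonempty : Nonempty V]
  graph : SimpleGraph V

namespace FinGraph

attribute [instance] FinGraph.finite FinGraph.nonempty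

/-- The number of vertices `|V(G)|`. -/
noncomputable def order (G : FinGraph) : ℕ := Nat.card G.V

/-- `G` and `H` are isomorphic. -/
def Isomorphic (G H : FinGraph) : Prop := Nonempty (G.graph ≃g H.graph)

/-- There are only finitely many homomorphisms between two graphs. -/
instance finite_hom (F G : FinGraph) : Finite (F.graph →g G.graph) :=
  Finite.of_injective (fun f : F.graph →g G.graph => (f : F.V → G.V)) DFunLike.coe_injective

/-- The number `hom(F, G)` of homomorphisms from `F` to `G`. -/
noncomputable def hom (F G : FinGraph) : ℕ := Nat.card (F.graph →g G.graph)

/-- The complete graph `K_n` on `n ≥ 1` vertices. -/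
def K (n : ℕ) [NeZero n] : FinGraph where
  V := Fin n
  graph := ⊤

/-- A class of graphs (all classes are closed under isomorphism). -/
def IsGraphClass (C : Set FinGraph) : Prop :=
  ∀ G H : FinGraph, Isomorphic G H → G ∈ C → H ∈ C

end FinGraph

/-- A `k` adaptive hom algorithm (`k ≥ 1`): a starting graph, a next graph function defined on the
tuples of natural numbers of length `1, …, k - 1`, and a set of accepted `k`-tuples. -/
structure AdaptiveHomAlgorithm (k : ℕ) where
  one_le : 1 ≤ k
  start : FinGraph
  next : (i : ℕ) → 1 ≤ i → i < k → (Fin i → ℕ) → FinGraph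
  accept : Set (Fin k → ℕ)

namespace AdaptiveHomAlgorithm

variable {k : ℕ}

/-- The graph queried after the answers `a = (n_1, …, n_i)` have been obtained. -/
def query (A : AdaptiveHomAlgorithm k) : (i : ℕ) → i < k → (Fin i → ℕ) → FinGraph
  | 0, _, _ => A.start
  | i + 1, h, a => A.next (i + 1) (Nat.succ_le_succ (Nat.zero_le i)) h a

/-- The first `i` answers `(n_1, …, n_i)` on input `G`. -/
noncomputable def answers (A : AdaptiveHomAlgorithm k) (G : FinGraph) :
    (i : ℕ) → i ≤ k → Fin i → ℕ
  | 0, _ => Fin.elim0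
  | i + 1, h =>
    Fin.snoc (α := fun _ => ℕ) (A.answers G i (Nat.le_of_succ_le h))
      (FinGraph.hom (A.query i h (A.answers G i (Nat.le_of_succ_le h))) G)

/-- `A` is an algorithm for `C`: a graph `G` is in `C` if and only if `(n_1, …, n_k)` is
accepted. -/
def Decides (A : AdaptiveHomAlgorithm k) (C : Set FinGraph) : Prop :=
  ∀ G : FinGraph, G ∈ C ↔ A.answers G k le_rfl ∈ A.accept

end AdaptiveHomAlgorithm

/-- `C` can be decided by a `k` adaptive hom algorithm. -/
def FinGraph.DecidedByAdaptive (C : Set FinGraph) (k : ℕ) : Prop :=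
  ∃ A : AdaptiveHomAlgorithm k, A.Decides C

/-! The counts from finitely many graphs `F` mapping to a fixed `P` fit into one count: disjoint
unions multiply counts, and in a product `x ^ k * f` of positive bounded factors a large `k` makes
both recoverable. Zeros would destroy the encoding, but if `P` maps to `G` then so does each `F`.

`P = K 2` records all bipartite `F` of order at most `n`. This suffices for bipartite `G`, since
other `F` have count zero and Lovász's theorem applies; edgeless `G` are trivial. For non-bipartite
`G`, `P` is an odd cycle mapping to every non-bipartite graph of order `n`. Counts from graphs over
that cycle yield bijections `φ c`, one per cycle vertex, that jointly preserve adjacency between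
consecutive indices; going once around the odd cycle makes `φ 0` an isomorphism. -/

/-! ### Inversion over a finite poset, and a power estimate. -/

theorem card_upper_eq_card_fiber_add_sum {S P : Type*} [Finite S] [PartialOrder P] (L : S → P)
    (p : P) [Fintype {q : P // p < q}] :
    Nat.card {t // p ≤ L t} =
      Nat.card {t // L t = p} + ∑ q : {q : P // p < q}, Nat.card {t // L t = q} := by
  classical
  rw [← Nat.card_sigma, ← Nat.card_sum]
  refine Nat.card_congr
    { toFun := fun t => if e : L t = p then Sum.inl ⟨t, e⟩ else
        Sum.inr ⟨⟨L t, lt_of_le_of_ne t.2 (Ne.symm e)⟩, ⟨t, rfl⟩⟩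
      invFun := Sum.elim (fun t => ⟨t, t.2.ge⟩)
        (fun t => ⟨t.2, t.1.2.le.trans t.2.2.ge⟩)
      left_inv := ?_
      right_inv := ?_ }
  · intro t
    by_cases e : L t = p <;> simp [e]
  · rintro (⟨t, e⟩ | ⟨⟨q, hq⟩, ⟨t, e⟩⟩)
    · simp [e]
    · change L t = q at e
      subst e
      simp [hq.ne']

/-- Möbius inversion, carried out as induction from the maximal elements downwards. -/
theorem card_fiber_eq_of_card_upper_eq {T T' P : Type*} [Finite T] [Finite T'] [PartialOrder P]
    [Finite P] (K : T → P) (K' : T' → P)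
    (h : ∀ p, Nat.card {t // p ≤ K t} = Nat.card {t // p ≤ K' t}) (p : P) :
    Nat.card {t // K t = p} = Nat.card {t // K' t = p} := by
  classical
  have := Fintype.ofFinite P
  induction p using WellFoundedGT.induction with
  | ind p ih =>
    have e := h p
    rw [card_upper_eq_card_fiber_add_sum, card_upper_eq_card_fiber_add_sum,
      Finset.sum_congr rfl (fun (q : {q : P // p < q}) _ => ih q q.2)] at e
    exact Nat.add_right_cancel e

/-- If `y ≥ x + 1`, Bernoulli makes the right side exceed `(M * M + 1) * x ^ (M * M)`, which already
bounds the left side because `x * f ≤ M * M`. -/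
theorem le_of_pow_mul_eq_pow_mul {M x y f f' : ℕ} (hx : 1 ≤ x) (hxM : x ≤ M) (hf : f ≤ M)
    (hf' : 1 ≤ f') (h : x ^ (M * M + 1) * f = y ^ (M * M + 1) * f') : y ≤ x := by
  by_contra! hlt
  have bern : ∀ k, x ^ (k + 1) + (k + 1) * x ^ k ≤ (x + 1) ^ (k + 1) := by
    intro k
    induction k with
    | zero => simp
    | succ k ih =>
      calc x ^ (k + 1 + 1) + (k + 1 + 1) * x ^ (k + 1)
          ≤ (x ^ (k + 1) + (k + 1) * x ^ k) * (x + 1) := by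
            ring_nf
            omega
        _ ≤ (x + 1) ^ (k + 1) * (x + 1) := Nat.mul_le_mul_right _ ih
        _ = _ := (pow_succ ..).symm
  have h1 : x ^ (M * M + 1) * f < (x + 1) ^ (M * M + 1) := by
    refine lt_of_lt_of_le ?_ (bern (M * M))
    have hp : 0 < x ^ (M * M + 1) := by positivity
    have : x ^ (M * M + 1) * f ≤ (M * M + 1) * x ^ (M * M) := by
      calc x ^ (M * M + 1) * f = (x * f) * x ^ (M * M) := by ring
        _ ≤ (M * M + 1) * x ^ (M * M) :=
          Nat.mul_le_mul_right _ ((Nat.mul_le_mul hxM hf).trans (Nat.le_succ _))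
    omega
  have h2 : (x + 1) ^ (M * M + 1) ≤ y ^ (M * M + 1) * f' :=
    (Nat.pow_le_pow_left hlt _).trans (Nat.le_mul_of_pos_right _ hf')
  omega

/-! ### Packing many homomorphism counts into one. -/

namespace FinGraph

theorem hom_ne_zero_iff {F G : FinGraph} : hom F G ≠ 0 ↔ Nonempty (F.graph →g G.graph) := by
  rw [hom, ← Nat.pos_iff_ne_zero, Nat.card_pos_iff]
  exact and_iff_left inferInstance

theorem hom_le (F G : FinGraph) : hom F G ≤ order G ^ order F := by
  rw [hom, order, order, ← Nat.card_fun]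
  exact Nat.card_le_card_of_injective (fun f : F.graph →g G.graph => (f : F.V → G.V))
    DFunLike.coe_injective

theorem hom_congr_left {F F' : FinGraph} (e : Isomorphic F F') (G : FinGraph) :
    hom F G = hom F' G := by
  obtain ⟨e⟩ := e
  exact Nat.card_congr
    { toFun := fun f => f.comp e.symm.toHom
      invFun := fun f => f.comp e.toHom
      left_inv := fun f => by ext x; simp
      right_inv := fun f => by ext x; simp }

theorem hom_K_one (G : FinGraph) : hom (K 1) G = order G :=
  Nat.card_congr
    { toFun := fun f => f (0 : Fin 1)
      invFun := fun v => ⟨fun _ => v, fun {a b} h => absurd (Subsingleton.elim (α := Fin 1) a b) h.ne⟩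
      left_inv := fun f => by
        ext x
        exact congrArg f (Subsingleton.elim (α := Fin 1) _ _)
      right_inv := fun _ => rfl }

/-- The disjoint union. -/
def sum (F F' : FinGraph) : FinGraph where
  V := F.V ⊕ F'.V
  graph := F.graph.sum F'.graph

theorem hom_sum (F F' G : FinGraph) : hom (F.sum F') G = hom F G * hom F' G := by
  rw [hom, hom, hom, ← Nat.card_prod]
  exact Nat.card_congr
    { toFun := fun f => (f.comp SimpleGraph.Embedding.sumInl.toHom,
        f.comp SimpleGraph.Embedding.sumInr.toHom)
      invFun := fun p => ⟨Sum.elim p.1 p.2, by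
        rintro (a | a) (b | b) h
        · exact p.1.map_rel (SimpleGraph.sum_adj_inl.1 h)
        · simp [sum] at h
        · simp [sum] at h
        · exact p.2.map_rel (SimpleGraph.sum_adj_inr.1 h)⟩
      left_inv := fun f => by ext (x | x) <;> rfl
      right_inv := fun p => rfl }

theorem exists_hom_eq_pow_mul (P F : FinGraph) (k : ℕ) :
    ∃ Q : FinGraph, ∀ G, hom Q G = hom P G ^ k * hom F G := by
  induction k with
  | zero => exact ⟨F, by simp⟩
  | succ k ih =>
    obtain ⟨Q, hQ⟩ := ih
    exact ⟨P.sum Q, fun G => by rw [hom_sum, hQ]; ring⟩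

/-- A single count that records the counts of finitely many graphs, as long as none of these
counts vanishes. -/
theorem exists_hom_determining_finite (n : ℕ) (P : FinGraph) {S : Set FinGraph} (hS : S.Finite)
    (hP : ∀ F ∈ S, Nonempty (F.graph →g P.graph)) :
    ∃ Q : FinGraph, (∀ G, hom Q G ≠ 0 ↔ hom P G ≠ 0) ∧
      ∀ G H : FinGraph, G.order = n → H.order = n → hom P G ≠ 0 → hom P H ≠ 0 →
        hom Q G = hom Q H → ∀ F ∈ S, hom F G = hom F H := by
  induction S, hS using Set.Finite.induction_on with
  | empty => exact ⟨P, by simp, by simp⟩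
  | @insert F S _ _ ih =>
    obtain ⟨Q, hQ, hQS⟩ := ih fun F hF => hP F (Set.mem_insert_of_mem _ hF)
    -- `M` bounds both counts on graphs of order `n`, as the power estimate requires.
    set M := n ^ order Q + n ^ order F with hM
    obtain ⟨Q', hQ'⟩ := exists_hom_eq_pow_mul Q F (M * M + 1)
    have hF : ∀ G, hom P G ≠ 0 → hom F G ≠ 0 := by
      intro G hG
      rw [hom_ne_zero_iff] at hG ⊢
      obtain ⟨e⟩ := hP F (Set.mem_insert _ _)
      exact hG.map fun f => f.comp e
    refine ⟨Q', fun G => ?_, ?_⟩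
    · rw [hQ', ← hQ]
      constructor
      · intro h h0
        simp [h0] at h
      · exact fun h => mul_ne_zero (pow_ne_zero _ h) (hF G ((hQ G).1 h))
    · intro G H hG hH hPG hPH e
      rw [hQ', hQ'] at e
      have bd : ∀ G : FinGraph, G.order = n → hom Q G ≤ M ∧ hom F G ≤ M := by
        rintro G rfl
        exact ⟨(hom_le Q G).trans (Nat.le_add_right _ _),
          (hom_le F G).trans (Nat.le_add_left _ _)⟩
      have pos := fun G (h : hom P G ≠ 0) => Nat.one_le_iff_ne_zero.2 ((hQ G).2 h)
      have posF := fun G (h : hom P G ≠ 0) => Nat.one_le_iff_ne_zero.2 (hF G h)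
      have hx : hom Q G = hom Q H := le_antisymm
        (le_of_pow_mul_eq_pow_mul (pos H hPH) (bd H hH).1 (bd H hH).2 (posF G hPG) e.symm)
        (le_of_pow_mul_eq_pow_mul (pos G hPG) (bd G hG).1 (bd G hG).2 (posF H hPH) e)
      rintro F' (rfl | hF')
      · rw [hx] at e
        exact Nat.eq_of_mul_eq_mul_left (Nat.pow_pos (pos H hPH)) e
      · exact hQS G H hG hH hPG hPH hx F' hF'

/-- A single count that records the counts of all graphs of bounded order mapping to `P`. -/
theorem exists_hom_determining_le (n N : ℕ) (P : FinGraph) :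
    ∃ Q : FinGraph, (∀ G, hom Q G ≠ 0 ↔ hom P G ≠ 0) ∧
      ∀ G H : FinGraph, G.order = n → H.order = n → hom P G ≠ 0 → hom P H ≠ 0 →
        hom Q G = hom Q H → ∀ F : FinGraph, F.order ≤ N → Nonempty (F.graph →g P.graph) →
          hom F G = hom F H := by
  let mk : (Σ m : Fin N, SimpleGraph (Fin (m + 1))) → FinGraph := fun x => ⟨Fin (x.1 + 1), x.2⟩
  obtain ⟨Q, hQ, h⟩ := exists_hom_determining_finite n P
    (S := Set.range mk ∩ {F | Nonempty (F.graph →g P.graph)})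
    ((Set.finite_range mk).subset Set.inter_subset_left) (fun F hF => hF.2)
  refine ⟨Q, hQ, fun G H hG hH hPG hPH e F hF hFP => ?_⟩
  obtain ⟨m, hm⟩ : ∃ m, F.order = m + 1 :=
    Nat.exists_eq_succ_of_ne_zero (Nat.card_pos (α := F.V)).ne'
  let u : F.V ≃ Fin (m + 1) := Finite.equivFinOfCardEq hm
  let F' : FinGraph := mk ⟨⟨m, by omega⟩, F.graph.map u.toEmbedding⟩
  let i : F.graph ≃g F'.graph := SimpleGraph.Iso.map u F.graph
  have hF' := h G H hG hH hPG hPH e F'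
    ⟨⟨_, rfl⟩, hFP.map fun f => f.comp i.symm.toHom⟩
  rwa [← hom_congr_left ⟨i⟩, ← hom_congr_left ⟨i⟩] at hF'

end FinGraph
-- Recovering a graph from the counts of graphs over a fixed relation.
namespace FinGraph

/-- The quotient of a graph by an equivalence relation with independent classes. -/
def quotient (F : FinGraph) (s : Setoid F.V) (hs : ∀ x y, s x y → ¬ F.graph.Adj x y) :
    FinGraph where
  V := Quotient s
  nonempty := F.nonempty.map (Quotient.mk s)
  graph :=
    { Adj := fun u v => ∃ x y, ⟦x⟧ = u ∧ ⟦y⟧ = v ∧ F.graph.Adj x y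
      symm := ⟨by
        rintro _ _ ⟨x, y, rfl, rfl, h⟩
        exact ⟨y, x, rfl, rfl, h.symm⟩⟩
      loopless := ⟨by
        rintro _ ⟨x, y, rfl, e, h⟩
        exact hs y x (Quotient.exact e) h.symm⟩ }

theorem hom_quotient_eq (F : FinGraph) (s : Setoid F.V)
    (hs : ∀ x y, s x y → ¬ F.graph.Adj x y) (G : FinGraph) :
    hom (F.quotient s hs) G =
      Nat.card {h : F.graph →g G.graph // ∀ x y, s x y → h x = h y} :=
  let mk : F.V → (F.quotient s hs).V := Quotient.mk s
  Nat.card_congr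
    { toFun := fun h => ⟨⟨fun x => h (mk x), fun {a b} e => h.map_rel ⟨a, b, rfl, rfl, e⟩⟩,
        fun x y e => congrArg h (Quotient.sound e)⟩
      invFun := fun h => ⟨fun x : Quotient s => Quotient.lift h.1 h.2 x, fun {u v} e => by
        obtain ⟨x, y, rfl, rfl, e⟩ := e
        exact h.1.map_rel e⟩
      left_inv := fun h => by
        ext x
        obtain ⟨x, rfl⟩ := Quotient.mk_surjective (s := s) x
        rfl
      right_inv := fun h => rfl }

/-- `A` and `B` have the same number of homomorphisms from each graph of order at most `N` that
admits a map to the relation `r`. -/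
def HomEquiv {W : Type} (r : W → W → Prop) (N : ℕ) (A B : FinGraph) : Prop :=
  ∀ F : FinGraph, F.order ≤ N → (∃ f : F.V → W, ∀ x y, F.graph.Adj x y → r (f x) (f y)) →
    hom F A = hom F B

theorem HomEquiv.symm {W : Type} {r : W → W → Prop} {N : ℕ} {A B : FinGraph}
    (h : HomEquiv r N A B) : HomEquiv r N B A :=
  fun F hF hf => (h F hF hf).symm

/-- Maps `h` are sorted by the kernel of `(h, f)`. Those whose kernel contains `s` are the
homomorphisms from the quotient by `s`, which still maps to `r` if `s` refines the kernel of `f`;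
otherwise there are none. Inversion then equates the numbers with trivial kernel. -/
theorem HomEquiv.exists_injective {W : Type} {r : W → W → Prop} {N : ℕ} {A B : FinGraph}
    (h : HomEquiv r N A B) (F : FinGraph) (hF : F.order ≤ N) (f : F.V → W)
    (hf : ∀ x y, F.graph.Adj x y → r (f x) (f y)) (i : F.graph →g A.graph)
    (hi : Function.Injective fun x => (i x, f x)) :
    ∃ j : F.graph →g B.graph, Function.Injective fun x => (j x, f x) := by
  let κ : ∀ G : FinGraph, (F.graph →g G.graph) → Setoid F.V :=
    fun G h => Setoid.ker fun x => (h x, f x)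
  have hκ : ∀ G h x y, κ G h x y ↔ h x = h y ∧ f x = f y := by
    intro G h x y
    rw [Setoid.ker_def, Prod.mk.injEq]
  have : Finite (Setoid F.V) := Finite.of_injective (fun s : Setoid F.V => s.r)
    fun s t e => Setoid.ext fun x y => iff_of_eq (congrFun (congrFun e x) y)
  have key := card_fiber_eq_of_card_upper_eq (κ A) (κ B) ?_ ⊥
  · have : Nonempty {h // κ A h = ⊥} := ⟨⟨i, Setoid.ker_eq_bot_iff.2 hi⟩⟩
    have pos := Nat.card_pos (α := {h // κ A h = ⊥})
    rw [key, Nat.card_pos_iff] at pos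
    obtain ⟨⟨j, hj⟩⟩ := pos.1
    exact ⟨j, Setoid.ker_eq_bot_iff.1 hj⟩
  · intro s
    by_cases hs : ∀ x y, s x y → f x = f y
    · have e : ∀ G h, s ≤ κ G h ↔ ∀ x y, s x y → h x = h y := by
        intro G h
        refine ⟨fun hle x y hxy => ((hκ G h x y).1 (hle hxy)).1,
          fun hle x y hxy => (hκ G h x y).2 ⟨hle x y hxy, hs x y hxy⟩⟩
      simp_rw [e]
      by_cases ha : ∀ x y, s x y → ¬ F.graph.Adj x y
      · rw [← hom_quotient_eq F s ha, ← hom_quotient_eq F s ha]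
        refine h _ ((Nat.card_le_card_of_surjective _ Quotient.mk_surjective).trans hF)
          ⟨Quotient.lift f hs, ?_⟩
        rintro _ _ ⟨x, y, rfl, rfl, hxy⟩
        exact hf x y hxy
      -- An edge inside a class of `s` would become a loop, so both counts vanish.
      · push Not at ha
        obtain ⟨x, y, hxy, ha⟩ := ha
        have emp : ∀ G : FinGraph,
            IsEmpty {h : F.graph →g G.graph // ∀ x y, s x y → h x = h y} :=
          fun G => ⟨fun h => (h.1.map_rel ha).ne (h.2 x y hxy)⟩
        have := emp A
        have := emp B
        simp
    · push Not at hs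
      obtain ⟨x, y, hxy, hne⟩ := hs
      have emp : ∀ G, IsEmpty {h // s ≤ κ G h} :=
        fun G => ⟨fun h => hne ((hκ G h.1 x y).1 (h.2 hxy)).2⟩
      have := emp A
      have := emp B
      simp

theorem HomEquiv.exists_injective_family {W : Type} [Finite W] [Nonempty W] {r : W → W → Prop}
    (hr : ∀ c c', r c c' → r c' c) {A B : FinGraph} (h : HomEquiv r (A.order * Nat.card W) A B) :
    ∃ φ : W → A.V → B.V, (∀ c, Function.Injective (φ c)) ∧
      ∀ c c', r c c' → ∀ a a', A.graph.Adj a a' → B.graph.Adj (φ c a) (φ c' a') := by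
  -- The tensor product of `A` with `r`: its two projections are jointly injective.
  let F : FinGraph :=
    { V := A.V × W
      graph :=
        { Adj := fun x y => A.graph.Adj x.1 y.1 ∧ r x.2 y.2
          symm := ⟨fun x y e => ⟨e.1.symm, hr _ _ e.2⟩⟩
          loopless := ⟨fun x e => e.1.ne rfl⟩ } }
  obtain ⟨j, hj⟩ := h.exists_injective F (Nat.card_prod _ _).le Prod.snd (fun x y e => e.2)
    ⟨Prod.fst, fun e => e.1⟩ (fun x y e => e)
  refine ⟨fun c a => j (a, c), fun c a a' e => ?_, fun c c' hc a a' ha => ?_⟩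
  · have := @hj (a, c) (a', c) (Prod.ext e rfl)
    exact congrArg Prod.fst this
  · exact j.map_rel (a := (a, c)) (b := (a', c')) ⟨ha, hc⟩

theorem HomEquiv.exists_equiv_family {W : Type} [Finite W] [Nonempty W] {r : W → W → Prop}
    (hr : ∀ c c', r c c' → r c' c) {A B : FinGraph} (hAB : A.order = B.order)
    (h : HomEquiv r (A.order * Nat.card W) A B) :
    ∃ φ : W → (A.V ≃ B.V), ∀ c c', r c c' → ∀ a a',
      A.graph.Adj a a' ↔ B.graph.Adj (φ c a) (φ c' a') := by
  obtain ⟨φ, hφ, hadj⟩ := h.exists_injective_family hr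
  obtain ⟨ψ, hψ, hadj'⟩ := HomEquiv.exists_injective_family hr (hAB ▸ h.symm)
  refine ⟨fun c => Equiv.ofBijective (φ c) ((hφ c).bijective_of_nat_card_le hAB.ge),
    fun c c' hc a a' => ⟨hadj c c' hc a a', fun hb => ?_⟩⟩
  -- Adjacency is reflected by counting: `φ` and `ψ` inject the darts of each graph into those of
  -- the other, so `Φ` is bijective.
  let D : FinGraph → Type := fun G => {p : G.V × G.V // G.graph.Adj p.1 p.2}
  let Φ : D A → D B := fun p => ⟨(φ c p.1.1, φ c' p.1.2), hadj c c' hc _ _ p.2⟩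
  let Ψ : D B → D A := fun p => ⟨(ψ c p.1.1, ψ c' p.1.2), hadj' c c' hc _ _ p.2⟩
  have hΦ : Function.Injective Φ := by
    rintro ⟨⟨a, b⟩, h1⟩ ⟨⟨a', b'⟩, h2⟩ e
    obtain ⟨e1, e2⟩ := Prod.mk.inj (congrArg Subtype.val e)
    obtain rfl := hφ c e1
    obtain rfl := hφ c' e2
    rfl
  have hΨ : Function.Injective Ψ := by
    rintro ⟨⟨a, b⟩, h1⟩ ⟨⟨a', b'⟩, h2⟩ e
    obtain ⟨e1, e2⟩ := Prod.mk.inj (congrArg Subtype.val e)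
    obtain rfl := hψ c e1
    obtain rfl := hψ c' e2
    rfl
  obtain ⟨⟨p, hp⟩, e⟩ := (hΦ.bijective_of_nat_card_le
    (Nat.card_le_card_of_injective Ψ hΨ)).2 ⟨(φ c a, φ c' a'), hb⟩
  obtain ⟨e1, e2⟩ := Prod.mk.inj (congrArg Subtype.val e)
  rwa [hφ c e1, hφ c' e2] at hp

/-- Lovász: bounded homomorphism counts determine a graph. -/
theorem isomorphic_of_hom_eq {A B : FinGraph} (hAB : A.order = B.order)
    (h : ∀ F : FinGraph, F.order ≤ A.order → hom F A = hom F B) : Isomorphic A B := by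
  -- A single looped point puts no restriction on `F`.
  obtain ⟨φ, hφ⟩ := HomEquiv.exists_equiv_family (W := Unit) (r := fun _ _ => True)
    (fun _ _ _ => trivial) hAB (fun F hF _ => h F (by simpa using hF))
  exact ⟨⟨φ (), fun {a b} => (hφ () () trivial a b).symm⟩⟩

/-! ### Odd cycles and non-bipartite graphs. -/

/-- The cycle graph on `ZMod g`. -/
def zmodCycle (g : ℕ) : SimpleGraph (ZMod g) :=
  SimpleGraph.fromRel fun x y => y = x + 1

/-- The cycle on `g` vertices (for `g ≥ 3`). -/
def cycle (g : ℕ) [NeZero g] : FinGraph where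
  V := ZMod g
  graph := zmodCycle g

theorem zmodCycle_adj_succ {g : ℕ} (hg : 1 < g) (x : ZMod g) :
    (zmodCycle g).Adj x (x + 1) := by
  have : Fact (1 < g) := ⟨hg⟩
  refine (SimpleGraph.fromRel_adj _ _ _).2 ⟨?_, Or.inl rfl⟩
  exact fun h => one_ne_zero (left_eq_add.1 h)

theorem isomorphic_of_hom_eq_of_odd_cycle {g : ℕ} [NeZero g] (hg : 1 < g) (hodd : Odd g)
    {A B : FinGraph} (hAB : A.order = B.order)
    (h : ∀ F : FinGraph, F.order ≤ A.order * g → Nonempty (F.graph →g (cycle g).graph) →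
      hom F A = hom F B) : Isomorphic A B := by
  obtain ⟨φ, hφ⟩ := HomEquiv.exists_equiv_family (W := ZMod g) (r := (zmodCycle g).Adj)
    (fun _ _ e => e.symm) hAB
    (fun F hF ⟨f, hf⟩ => h F (by simpa using hF) ⟨⟨f, fun {a b} => hf a b⟩⟩)
  have key : ∀ k : ℕ, ∀ a a',
      A.graph.Adj a a' ↔ B.graph.Adj (φ 0 a) (φ ((2 * k + 1 : ℕ) : ZMod g) a') := by
    intro k
    induction k with
    | zero =>
      have e := hφ _ _ (zmodCycle_adj_succ hg 0)
      rw [zero_add] at e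
      simpa using e
    | succ k ih =>
      intro a a'
      have e1 := hφ _ _ (zmodCycle_adj_succ hg ((2 * k + 1 : ℕ) : ZMod g)).symm
      have e2 := hφ _ _ (zmodCycle_adj_succ hg (((2 * k + 1 : ℕ) : ZMod g) + 1))
      have e3 : (((2 * (k + 1) + 1 : ℕ) : ZMod g)) = ((2 * k + 1 : ℕ) : ZMod g) + 1 + 1 := by
        push_cast
        ring
      rw [e3]
      -- With `j = 2 * k + 1`, the index `j + 1` is adjacent to both `j` and `j + 2`, so replacing
      -- `φ (j + 2) a'` by `φ j b` turns `a'` into a vertex `b` with the same neighbours in `A`.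
      obtain ⟨b, hb⟩ := (φ ((2 * k + 1 : ℕ) : ZMod g)).surjective
        (φ (((2 * k + 1 : ℕ) : ZMod g) + 1 + 1) a')
      rw [e2, ← hb, ← e1, ih]
  obtain ⟨k, hk⟩ := hodd
  refine ⟨⟨φ 0, fun {a b} => ?_⟩⟩
  have := key k a b
  rw [← hk, ZMod.natCast_self] at this
  exact this.symm

theorem not_colorable_zmodCycle {g : ℕ} (hg : 1 < g) (hodd : Odd g) :
    ¬ (zmodCycle g).Colorable 2 := by
  rintro ⟨c⟩
  have key : ∀ k : ℕ, c ((2 * k : ℕ) : ZMod g) = c (0 : ZMod g) := by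
    intro k
    induction k with
    | zero => simp
    | succ k ih =>
      have h1 := c.valid (zmodCycle_adj_succ hg ((2 * k : ℕ) : ZMod g))
      have h2 := c.valid (zmodCycle_adj_succ hg (((2 * k : ℕ) : ZMod g) + 1))
      have e3 : ((2 * (k + 1) : ℕ) : ZMod g) = ((2 * k : ℕ) : ZMod g) + 1 + 1 := by
        push_cast
        ring
      rw [e3, ← ih]
      omega
  obtain ⟨k, hk⟩ := hodd
  have h1 := c.valid (zmodCycle_adj_succ hg ((2 * k : ℕ) : ZMod g))
  refine h1 ((key k).trans (congrArg c ?_))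
  rw [← Nat.cast_succ, ← Nat.add_one, ← hk, ZMod.natCast_self]

theorem nonempty_cycle_hom {g : ℕ} [NeZero g] {G : FinGraph} {p : ℕ → G.V}
    (hp : ∀ i, G.graph.Adj (p i) (p (i + 1))) (hper : Function.Periodic p g) :
    Nonempty (zmodCycle g →g G.graph) := by
  have key : ∀ x : ZMod g, G.graph.Adj (p x.val) (p (x + 1).val) := by
    intro x
    have : p (x + 1).val = p (x.val + 1) := by
      rw [← hper.map_mod_nat (x.val + 1), ZMod.val_add, ZMod.val_one_eq_one_mod, Nat.add_mod_mod]
    rw [this]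
    exact hp _
  refine ⟨⟨fun x : ZMod g => p x.val, fun {x y} h => ?_⟩⟩
  rcases ((SimpleGraph.fromRel_adj _ _ _).1 h).2 with rfl | rfl
  · exact key x
  · exact (key y).symm

theorem exists_odd_periodic (G : FinGraph) (hG : ¬ G.graph.Colorable 2) :
    ∃ (l : ℕ) (p : ℕ → G.V), Odd l ∧ (∀ i, G.graph.Adj (p i) (p (i + 1))) ∧
      Function.Periodic p l := by
  rw [SimpleGraph.two_colorable_iff_forall_loop_even] at hG
  push Not at hG
  obtain ⟨u, w, hw⟩ := hG
  rw [Nat.not_even_iff_odd] at hw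
  have hpos := hw.pos
  refine ⟨w.length, fun i => w.getVert (i % w.length), hw, fun i => ?_, fun i => by simp⟩
  have hlt := Nat.mod_lt i hpos
  have hadj := w.adj_getVert_succ hlt
  rcases (Nat.succ_le_of_lt hlt).lt_or_eq with h | h
  · have : (i + 1) % w.length = i % w.length + 1 := by
      rw [← Nat.mod_add_mod, Nat.mod_eq_of_lt h]
    simpa only [this] using hadj
  · have : (i + 1) % w.length = 0 := by
      rw [← Nat.mod_add_mod, ← Nat.succ_eq_add_one, h, Nat.mod_self]
    rw [← Nat.succ_eq_add_one, h, w.getVert_length] at hadj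
    simpa only [this, w.getVert_zero] using hadj

/-- Some odd cycle maps to every non-bipartite graph of order `n`. -/
theorem exists_universal_odd_cycle (n : ℕ) : ∃ (g : ℕ) (_ : NeZero g), 1 < g ∧ Odd g ∧
    ∀ G : FinGraph, G.order = n → ¬ G.graph.Colorable 2 →
      Nonempty ((cycle g).graph →g G.graph) := by
  classical
  have ex : ∀ G : SimpleGraph (Fin n), ∃ l : ℕ, Odd l ∧ (¬ G.Colorable 2 →
      ∃ p : ℕ → Fin n, (∀ i, G.Adj (p i) (p (i + 1))) ∧ Function.Periodic p l) := by
    intro G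
    by_cases hG : G.Colorable 2
    · exact ⟨1, odd_one, fun h => absurd hG h⟩
    · have : Nonempty (Fin n) := by
        by_contra hn
        rw [not_nonempty_iff] at hn
        exact hG ⟨⟨fun x => isEmptyElim x, fun {x} => isEmptyElim x⟩⟩
      obtain ⟨l, p, hl, h⟩ := exists_odd_periodic ⟨Fin n, G⟩ hG
      exact ⟨l, hl, fun _ => ⟨p, h⟩⟩
  choose l hl hp using ex
  -- A common odd multiple of all the periods; the factor 3 keeps it above 1.
  have hodd : Odd (3 * ∏ G, l G) :=
    Odd.mul (by decide) (Finset.prod_induction _ Odd (fun _ _ => Odd.mul) odd_one fun G _ => hl G)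
  have hprod : 0 < ∏ G, l G := Finset.prod_pos fun G _ => (hl G).pos
  have hne : NeZero (3 * ∏ G, l G) := ⟨by omega⟩
  refine ⟨3 * ∏ G, l G, hne, by omega, hodd, fun G hG hcol => ?_⟩
  let u : G.V ≃ Fin n := Finite.equivFinOfCardEq hG
  let i : G.graph ≃g G.graph.map u.toEmbedding := SimpleGraph.Iso.map u G.graph
  obtain ⟨p, hadj, hper⟩ := hp (G.graph.map u.toEmbedding)
    fun h => hcol (h.of_hom i.toHom)
  obtain ⟨m, hm⟩ := (Finset.dvd_prod_of_mem l
    (Finset.mem_univ (G.graph.map u.toEmbedding))).mul_left 3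
  refine nonempty_cycle_hom (p := fun k => i.symm (p k))
    (fun k => i.symm.toHom.map_rel (hadj k)) fun k => congrArg i.symm ?_
  rw [hm, mul_comm]
  exact hper.nat_mul m k

theorem hom_K_two_ne_zero_of_adj {G : FinGraph} {a b : G.V} (h : G.graph.Adj a b) :
    hom (K 2) G ≠ 0 := by
  rw [hom_ne_zero_iff]
  let f : Fin 2 → G.V := ![a, b]
  have hf : ∀ x y : Fin 2, x ≠ y → G.graph.Adj (f x) (f y) := by
    intro x y hxy
    fin_cases x <;> fin_cases y
    · exact absurd rfl hxy
    · exact h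
    · exact h.symm
    · exact absurd rfl hxy
  exact ⟨⟨f, fun {x y} hxy => hf x y hxy.ne⟩⟩

theorem isomorphic_of_edgeless {G H : FinGraph} (e : G.order = H.order)
    (hG : hom (K 2) G = 0) (hH : hom (K 2) H = 0) : Isomorphic G H := by
  refine ⟨⟨(Finite.equivFinOfCardEq e).trans (Finite.equivFin _).symm, fun {a b} => ?_⟩⟩
  constructor
  · exact fun h => absurd hH (hom_K_two_ne_zero_of_adj h)
  · exact fun h => absurd hG (hom_K_two_ne_zero_of_adj h)

/-! ### The two determining graphs and the algorithm. -/

theorem exists_two_determining_graphs (n : ℕ) : ∃ F₁ F₂ : FinGraph, ∀ G H : FinGraph,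
    G.order = n → H.order = n → hom F₁ G = hom F₁ H → hom F₂ G = hom F₂ H →
      Isomorphic G H := by
  obtain ⟨g, _, hg, hodd, huniv⟩ := exists_universal_odd_cycle n
  obtain ⟨F₁, hF₁, det₁⟩ := exists_hom_determining_le n n (K 2)
  obtain ⟨F₂, hF₂, det₂⟩ := exists_hom_determining_le n (n * g) (cycle g)
  refine ⟨F₁, F₂, fun G H hG hH h₁ h₂ => ?_⟩
  have hcyc : ∀ G : FinGraph, G.order = n → (hom (cycle g) G ≠ 0 ↔ ¬ G.graph.Colorable 2) := by
    intro G hG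
    rw [hom_ne_zero_iff]
    exact ⟨fun ⟨f⟩ hc => not_colorable_zmodCycle hg hodd (hc.of_hom f), huniv G hG⟩
  have hcol : G.graph.Colorable 2 ↔ H.graph.Colorable 2 := by
    rw [← not_iff_not, ← hcyc G hG, ← hcyc H hH, ← hF₂, ← hF₂, h₂]
  have hGH := hG.trans hH.symm
  by_cases hc : G.graph.Colorable 2
  · have hedge : hom (K 2) G ≠ 0 ↔ hom (K 2) H ≠ 0 := by rw [← hF₁, ← hF₁, h₁]
    by_cases h0 : hom (K 2) G = 0
    · exact isomorphic_of_edgeless hGH h0 (by tauto)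
    · refine isomorphic_of_hom_eq hGH fun F hF => ?_
      by_cases hFc : F.graph.Colorable 2
      · exact det₁ G H hG hH h0 (hedge.1 h0) h₁ F (hF.trans hG.le) hFc
      · have zero : ∀ G : FinGraph, G.graph.Colorable 2 → hom F G = 0 := by
          intro G hG
          by_contra hne
          obtain ⟨f⟩ := hom_ne_zero_iff.1 hne
          exact hFc (hG.of_hom f)
        rw [zero G hc, zero H (hcol.1 hc)]
  · refine isomorphic_of_hom_eq_of_odd_cycle hg hodd hGH fun F hF hFc => ?_
    exact det₂ G H hG hH ((hcyc G hG).2 hc) ((hcyc H hH).2 (fun h => hc (hcol.2 h))) h₂ F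
      (hG ▸ hF) hFc

/-- The three-query algorithm with starting graph `K 1` that accepts the answers seen on `C`. -/
def threeQueryAlgorithm (F₁ F₂ : ℕ → FinGraph) (C : Set FinGraph) : AdaptiveHomAlgorithm 3 where
  one_le := by norm_num
  start := K 1
  next
    | 1, _, _, a => F₁ (a 0)
    | 2, _, _, a => F₂ (a 0)
    -- Never reached, as `1 ≤ i < 3`.
    | _, _, _, _ => K 1
  accept := {t | ∃ G ∈ C, t 0 = hom (K 1) G ∧ t 1 = hom (F₁ (t 0)) G ∧ t 2 = hom (F₂ (t 0)) G}

theorem threeQueryAlgorithm_answers (F₁ F₂ : ℕ → FinGraph) (C : Set FinGraph) (G : FinGraph) :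
    (threeQueryAlgorithm F₁ F₂ C).answers G 3 le_rfl =
      ![hom (K 1) G, hom (F₁ (hom (K 1) G)) G, hom (F₂ (hom (K 1) G)) G] := by
  ext i
  fin_cases i <;> rfl

end FinGraph

theorem mainTheorem2 :
    ∃ F₁ F₂ : ℕ → FinGraph,
      (∀ n : ℕ, 1 ≤ n → ∀ G H : FinGraph, G.order = n → H.order = n →
        FinGraph.hom (F₁ n) G = FinGraph.hom (F₁ n) H →
        FinGraph.hom (F₂ n) G = FinGraph.hom (F₂ n) H →
        FinGraph.Isomorphic G H) ∧
      (∀ (G H : FinGraph) (n₀ : ℕ),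
        n₀ = FinGraph.hom (FinGraph.K 1) G →
        FinGraph.hom (FinGraph.K 1) G = FinGraph.hom (FinGraph.K 1) H →
        FinGraph.hom (F₁ n₀) G = FinGraph.hom (F₁ n₀) H →
        FinGraph.hom (F₂ n₀) G = FinGraph.hom (F₂ n₀) H →
        FinGraph.Isomorphic G H) ∧
      (∀ C : Set FinGraph, FinGraph.IsGraphClass C →
        ∃ A : AdaptiveHomAlgorithm 3,
          A.start = FinGraph.K 1 ∧
          (∀ n : ℕ, A.next 1 (by norm_num) (by norm_num) ![n] = F₁ n) ∧
          (∀ n n' : ℕ, A.next 2 (by norm_num) (by norm_num) ![n, n'] = F₂ n) ∧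
          A.Decides C) ∧
      (∀ C : Set FinGraph, FinGraph.IsGraphClass C → FinGraph.DecidedByAdaptive C 3) := by
  choose F₁ F₂ h using FinGraph.exists_two_determining_graphs
  have dec : ∀ C : Set FinGraph, FinGraph.IsGraphClass C →
      (FinGraph.threeQueryAlgorithm F₁ F₂ C).Decides C := by
    intro C hC G
    rw [FinGraph.threeQueryAlgorithm_answers]
    refine ⟨fun hG => ⟨G, hG, rfl, rfl, rfl⟩, ?_⟩
    rintro ⟨H, hH, e0, e1, e2⟩
    replace e0 : FinGraph.hom (FinGraph.K 1) G = FinGraph.hom (FinGraph.K 1) H := e0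
    refine hC H G ?_ hH
    have eo : G.order = H.order := by rwa [FinGraph.hom_K_one, FinGraph.hom_K_one] at e0
    exact h _ H G (eo.symm.trans (FinGraph.hom_K_one G).symm) (FinGraph.hom_K_one G).symm
      e1.symm e2.symm
  refine ⟨F₁, F₂, fun n _ => h n, ?_, ?_, fun C hC => ⟨_, dec C hC⟩⟩
  · intro G H n₀ h0 e h1 h2
    rw [FinGraph.hom_K_one] at h0 e
    rw [FinGraph.hom_K_one] at e
    exact h n₀ G H h0.symm (e.symm.trans h0.symm) h1 h2
  · exact fun C hC => ⟨FinGraph.threeQueryAlgorithm F₁ F₂ C, rfl, fun _ => rfl, fun _ _ => rfl,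
      dec C hC⟩
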